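/- Let $q\ge 7$ be a prime power and let $a,b,c,u,v\in\mathbb{F}_{q^2}$ satisfy $a^{q+1}=b^{q+1}$ and $av\neq bu$. Put $A=bu-av$, $B=au^q-bv^q$, and for a positive integer $r$ let $$f_r(x)=(ax^q+bx+c)^r+ux^q+vx .$$ For an integer $1\le m\le q^2$, the polynomial $f_r$ is called $m$-to-$1$ on $\mathbb{F}_{q^2}$ if there are $\lfloor q^2/m\rfloor$ distinct elements of $\mathbb{F}_{q^2}$ each of which has exactly $m$ preimages in $\mathbb{F}_{q^2}$ under $x\mapsto f_r(x)$. Let $1\le m\le q$. For $\alpha,\beta,\gamma\in\mathbb{F}_{q^2}$ consider the following seven cases: (1) $m=1$, $\alpha=0$, $a^qc=bc^q$, and $u^{q+1}\ne v^{q+1}$; (2) $m=1$, $2\mid q$, $\alpha=0$, $a^qc\ne bc^q$, and $\gamma=0$; (3) $m=1$, $q\equiv 2\pmod 3$, $\alpha\neq0$, and $\beta^2=3a^qb\,\alpha\gamma$; (4) $m=1$, $3\mid q$, $\alpha\ne0$, $\beta=0$, and $(-\alpha\gamma)^{\frac{q-1}{2}}\ne(ab^{-q})^{\frac{q+1}{2}}$;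 (5) $m=2$, $2\mid q$, $\alpha=0$, $a^qc\neq bc^q$, and $\gamma\ne0$; (6) $m=3$, $3\mid q$, $\alpha\ne0$, $\beta=0$, and $(-\alpha\gamma)^{\frac{q-1}{2}}=(ab^{-q})^{\frac{q+1}{2}}$; (7) $m=q$, $\alpha=0$, $\beta=0$, and $\gamma=0$. Then: (i) Let $\alpha=B+B^q$, $\beta=(2a^qc+bc^q)B+(a^qc+2bc^q)B^q$, $\gamma=2\alpha c^{q+1}+Ac^{2q}+A^qc^2+u^{q+1}-v^{q+1}$. Then $f_{q+2}$ is $m$-to-$1$ on $\mathbb{F}_{q^2}$ if and only if one of (1)–(7) holds. (ii) Let $\alpha=A+A^q$, $\beta=(2a^qc+bc^q)A+(a^qc+2bc^q)A^q$, $\gamma=2\alpha c^{q+1}+Bc^{2q}+B^qc^2+u^{q+1}-v^{q+1}$. Then $f_{2q+1}$ is $m$-to-$1$ on $\mathbb{F}_{q^2}$ if and only if one of (1)–(7) holds. -/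

import Mathlib

open Polynomial

/-- A map `f` from a finite set `A` to `B` is *many-to-one* with multiplicity `m`, where
`1 ≤ m ≤ #A`, if, writing `#A = k * m + r` with `0 ≤ r < m` (so `k = #A / m`), there are `k`
distinct elements of `B` each of which has exactly `m` preimages in `A` under `f`. -/
def IsManyToOne {A B : Type*} [Finite A] (m : ℕ) (f : A → B) : Prop :=
  1 ≤ m ∧ m ≤ Nat.card A ∧
    ∃ T : Finset B, T.card = Nat.card A / m ∧ ∀ y ∈ T, (f ⁻¹' {y}).ncard = m

/-- A polynomial over a finite field is `m`-to-1 on that field if the map `x ↦ P(x)` is. -/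
def PolyIsManyToOne {F : Type*} [Field F] [Finite F] (m : ℕ) (P : F[X]) : Prop :=
  IsManyToOne m (fun x : F => P.eval x)

/-- The polynomial `f_r(x) = (a x^q + b x + c)^r + u x^q + v x`. -/
noncomputable def fPoly {F : Type*} [Field F] (q r : ℕ) (a b c u v : F) : F[X] :=
  (C a * X ^ q + C b * X + C c) ^ r + C u * X ^ q + C v * X

/-- The disjunction of the seven cases, for given `q`, `m`, `a`, `b`, `c`, `u`, `v` and given
values of the quantities `α`, `β`, `γ`. -/
def SevenCases {F : Type*} [Field F] (q m : ℕ) (a b c u v α β γ : F) : Prop :=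
  (m = 1 ∧ α = 0 ∧ a ^ q * c = b * c ^ q ∧ u ^ (q + 1) ≠ v ^ (q + 1)) ∨
  (m = 1 ∧ 2 ∣ q ∧ α = 0 ∧ a ^ q * c ≠ b * c ^ q ∧ γ = 0) ∨
  (m = 1 ∧ q ≡ 2 [MOD 3] ∧ α ≠ 0 ∧ β ^ 2 = 3 * a ^ q * b * α * γ) ∨
  (m = 1 ∧ 3 ∣ q ∧ α ≠ 0 ∧ β = 0 ∧
    (-(α * γ)) ^ ((q - 1) / 2) ≠ (a * (b ^ q)⁻¹) ^ ((q + 1) / 2)) ∨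
  (m = 2 ∧ 2 ∣ q ∧ α = 0 ∧ a ^ q * c ≠ b * c ^ q ∧ γ ≠ 0) ∨
  (m = 3 ∧ 3 ∣ q ∧ α ≠ 0 ∧ β = 0 ∧
    (-(α * γ)) ^ ((q - 1) / 2) = (a * (b ^ q)⁻¹) ^ ((q + 1) / 2)) ∨
  (m = q ∧ α = 0 ∧ β = 0 ∧ γ = 0)

/-! Write `φ x = x ^ q`, `ℓ x = a * φ x + b * x`, and let `K` be the fixed field of `φ`, of order
`q`. As a and b have equal norms, every value z of `ℓ` satisfies `φ z = e * z` with `e = φ a / b`,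
so `ℓ` maps onto a line τK. The map `w ↦ A * φ w + B * w` has the same image. Dividing both by τ
gives q-to-1 additive maps `lam`, `p` onto `K`, and `p ∘ f = g ∘ lam` for a cubic `g` over `K` whose
nonconstant coefficients are `e * α * τ ^ 2`, `β / b * τ` and `γ`.

Since av ≠ bu, x is determined by `ℓ x` and `u * φ x + v * x`, so `f` carries each fibre of `lam`
bijectively onto a fibre of `p`. Hence w has as many preimages under `f` as `p w` has under `g`.
Because m ≤ q, `f` is m-to-1 exactly when all nonempty fibres of `g` have m elements
(`isManyToOne_iff_hasFiberCard`).

Such cubics are classified in `hasFiberCard_cubic`. Additive cubics are settled by their kernels,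
and odd-characteristic quadratics by symmetry about the vertex. The rest follow from a power-sum
test in the style of Hermite's criterion, plus the bijectivity of cubing when q ≡ 2 mod 3. -/

/-- Every nonempty fibre of `g` has exactly `m` elements. -/
def HasFiberCard {S T : Type*} (m : ℕ) (g : S → T) : Prop :=
  ∀ t, (g ⁻¹' {g t}).ncard = m

theorem HasFiberCard.unique {S T : Type*} [Nonempty S] {m n : ℕ} {g : S → T}
    (hm : HasFiberCard m g) (hn : HasFiberCard n g) : m = n :=
  (hm (Classical.arbitrary S)).symm.trans (hn _)

theorem HasFiberCard.iff_eq {S T : Type*} [Nonempty S] {m n : ℕ} {g : S → T}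
    (hn : HasFiberCard n g) : HasFiberCard m g ↔ m = n :=
  ⟨fun hm => hm.unique hn, fun h => h ▸ hn⟩

theorem Function.Injective.hasFiberCard_one {S T : Type*} {g : S → T}
    (hg : Function.Injective g) : HasFiberCard 1 g := by
  intro t
  rw [Set.ncard_eq_one]
  exact ⟨t, by ext s; simp [hg.eq_iff]⟩

theorem HasFiberCard.injective {S T : Type*} {g : S → T} (h : HasFiberCard 1 g) :
    Function.Injective g := by
  intro s t hst
  obtain ⟨x, hx⟩ := Set.ncard_eq_one.1 (h t)
  have h1 : s ∈ g ⁻¹' {g t} := hst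
  have h2 : t ∈ g ⁻¹' {g t} := rfl
  rw [hx] at h1 h2
  exact h1.trans h2.symm

theorem hasFiberCard_comp_injective {S T U : Type*} {m : ℕ} {g : S → T} {i : T → U}
    (hi : Function.Injective i) : HasFiberCard m (fun s => i (g s)) ↔ HasFiberCard m g := by
  refine forall_congr' fun t => ?_
  rw [show (fun s => i (g s)) ⁻¹' {i (g t)} = g ⁻¹' {g t} by ext s; simp [hi.eq_iff]]

theorem hasFiberCard_comp_equiv {S T U : Type*} {m : ℕ} {g : S → T} (e : U ≃ S) :
    HasFiberCard m (fun s => g (e s)) ↔ HasFiberCard m g := by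
  rw [HasFiberCard, HasFiberCard, ← e.forall_congr_right (q := fun t => (g ⁻¹' {g t}).ncard = m)]
  refine forall_congr' fun t => ?_
  rw [show (fun s => g (e s)) ⁻¹' {g (e t)} = e ⁻¹' (g ⁻¹' {g (e t)}) from rfl,
    Set.ncard_preimage_of_injective_subset_range e.injective (by simp)]

theorem AddMonoidHom.hasFiberCard_ker {G H : Type*} [AddGroup G] [AddGroup H] (g : G →+ H) :
    HasFiberCard (Nat.card g.ker) g := by
  intro t
  have : g ⁻¹' {g t} = (fun s => t + s) '' (g.ker : Set G) := by
    ext s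
    simp only [Set.mem_preimage, Set.mem_singleton_iff, Set.mem_image, SetLike.mem_coe,
      AddMonoidHom.mem_ker]
    constructor
    · intro h
      exact ⟨-t + s, by simp [h], by simp⟩
    · rintro ⟨x, hx, rfl⟩
      simp [hx]
  rw [this, Set.ncard_image_of_injective _ (add_right_injective t)]
  rfl

/-! ### Power sums over a finite field -/

section FiniteField

variable {K : Type*} [Field K] [Fintype K]

theorem natCast_prime_eq_zero_iff_dvd_card {l : ℕ} (hl : l.Prime) :
    (l : K) = 0 ↔ l ∣ Fintype.card K := by
  obtain ⟨p, _, n, hp, hn⟩ := FiniteField.card' K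
  rw [CharP.cast_eq_zero_iff K p, hn, Nat.prime_dvd_prime_iff_eq hp hl]
  constructor
  · rintro rfl
    exact dvd_pow_self _ n.pos.ne'
  · intro h
    exact ((Nat.prime_dvd_prime_iff_eq hl hp).1 (hl.dvd_of_dvd_pow h)).symm

theorem sum_pow_eq_neg_one_or_zero {i : ℕ} (hi : 0 < i) :
    ∑ t : K, t ^ i = if Fintype.card K - 1 ∣ i then -1 else 0 := by
  classical
  rw [← FiniteField.sum_pow_units K i, ← Finset.sum_subset (Finset.subset_univ
    (Finset.univ.erase (0 : K)))]
  · symm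
    refine Finset.sum_bij (fun u _ => (u : K)) ?_ ?_ ?_ ?_
    · simp
    · intro u _ v _ h
      exact Units.ext h
    · intro t ht
      exact ⟨Units.mk0 t (Finset.ne_of_mem_erase ht), by simp, rfl⟩
    · simp
  · intro t _ ht
    have : t = 0 := by simpa using ht
    rw [this, zero_pow hi.ne']

/-- The j-th binomial term has t-exponent sk + (r - s)j, which lies strictly between 0 and twice
`Fintype.card K - 1`. Only the exponent equal to `Fintype.card K - 1` has a nonzero power sum, and
it occurs at `j₀` alone. -/
theorem sum_binomial_pow (x y : K) {r s k j₀ : ℕ} (hs : 0 < s) (hsr : s < r) (hk : 0 < k)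
    (hj₀ : j₀ ≤ k) (h₀ : r * j₀ + s * (k - j₀) = Fintype.card K - 1)
    (hlt : r * k < 2 * (Fintype.card K - 1)) :
    ∑ t : K, (x * t ^ r + y * t ^ s) ^ k = -(k.choose j₀ * x ^ j₀ * y ^ (k - j₀)) := by
  have key : ∀ j ∈ Finset.range (k + 1),
      ∑ t : K, (x * t ^ r) ^ j * (y * t ^ s) ^ (k - j) * (k.choose j : K) =
        if j = j₀ then -(k.choose j₀ * x ^ j₀ * y ^ (k - j₀)) else 0 := by
    intro j hj
    have hjk : j ≤ k := Nat.lt_succ_iff.1 (Finset.mem_range.1 hj)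
    have e1 : ∀ t : K, (x * t ^ r) ^ j * (y * t ^ s) ^ (k - j) * (k.choose j : K) =
        (k.choose j * x ^ j * y ^ (k - j)) * t ^ (r * j + s * (k - j)) := by
      intro t
      rw [mul_pow, mul_pow, ← pow_mul, ← pow_mul, pow_add]
      ring
    simp_rw [e1]
    obtain ⟨d, rfl⟩ : ∃ d, k = j + d := ⟨k - j, by omega⟩
    obtain ⟨c, rfl⟩ : ∃ c, r = s + c := ⟨r - s, by omega⟩
    have hc : 0 < c := by omega
    have ex : (s + c) * j + s * (j + d - j) = s * (j + d) + c * j := by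
      rw [Nat.add_sub_cancel_left]; ring
    obtain ⟨d₀, hd₀⟩ : ∃ d₀, j + d = j₀ + d₀ := ⟨j + d - j₀, by omega⟩
    have ex₀ : (s + c) * j₀ + s * (j + d - j₀) = s * (j + d) + c * j₀ := by
      rw [hd₀, Nat.add_sub_cancel_left]; ring
    rw [ex₀] at h₀
    have hpos : 0 < s * (j + d) + c * j := by positivity
    rw [← Finset.mul_sum, ex, sum_pow_eq_neg_one_or_zero hpos]
    have hb : s * (j + d) + c * j < 2 * (Fintype.card K - 1) := by
      refine lt_of_le_of_lt ?_ hlt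
      nlinarith [Nat.zero_le (c * d)]
    have hiff : Fintype.card K - 1 ∣ s * (j + d) + c * j ↔ j = j₀ := by
      constructor
      · rintro ⟨z, hz⟩
        have hz1 : z = 1 := by
          have h1 : z ≠ 0 := by rintro rfl; omega
          have h2 : z < 2 := by
            by_contra h
            have : 2 * (Fintype.card K - 1) ≤ (Fintype.card K - 1) * z := by
              rw [mul_comm]; exact Nat.mul_le_mul_left _ (by omega)
            omega
          omega
        subst hz1
        have : c * j = c * j₀ := by omega
        exact Nat.eq_of_mul_eq_mul_left hc this
      · rintro rfl
        rw [h₀]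
    by_cases h : j = j₀
    · rw [if_pos (hiff.2 h), if_pos h, h]; ring
    · rw [if_neg (fun h' => h (hiff.1 h')), if_neg h, mul_zero]
  simp_rw [add_pow]
  rw [Finset.sum_comm, Finset.sum_congr rfl key, Finset.sum_ite_eq' ]
  rw [if_pos (Finset.mem_range.2 (by omega))]

theorem HasFiberCard.dvd_card {S T : Type*} [Fintype S] {m : ℕ} {g : S → T}
    (h : HasFiberCard m g) : m ∣ Fintype.card S := by
  classical
  rw [← Finset.card_univ, Finset.card_eq_sum_card_image g]
  refine Finset.dvd_sum fun y hy => ?_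
  obtain ⟨t, _, rfl⟩ := Finset.mem_image.1 hy
  rw [← h t, ← Set.ncard_coe_finset]
  exact dvd_of_eq (congrArg _ (by ext; simp))

/-- As m divides the order of `K`, it is 1 or a multiple of the characteristic. In the first case
`g` permutes `K` and the sum is a plain power sum; in the second each fibre contributes a multiple
of m, which is 0 in `K`. -/
theorem HasFiberCard.sum_pow_eq_zero {m : ℕ} {g : K → K} (h : HasFiberCard m g) {k : ℕ}
    (hk : k < Fintype.card K - 1) : ∑ t, g t ^ k = 0 := by
  classical
  by_cases hm : m = 1
  · subst hm
    have hb : Function.Bijective g := Finite.injective_iff_bijective.1 h.injective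
    rw [hb.sum_comp (fun s => s ^ k)]
    exact FiniteField.sum_pow_lt_card_sub_one K k hk
  · have hm0 : (m : K) = 0 := by
      obtain ⟨p, _, n, hp, hn⟩ := FiniteField.card' K
      rw [CharP.cast_eq_zero_iff K p]
      obtain ⟨i, _, hi⟩ := (Nat.dvd_prime_pow hp).1 (hn ▸ h.dvd_card)
      rw [hi]
      refine dvd_pow_self p ?_
      rintro rfl
      exact hm (by simpa using hi)
    rw [← Finset.sum_fiberwise_of_maps_to (t := Finset.univ.image g) (g := g)
      (fun t ht => Finset.mem_image_of_mem g ht)]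
    refine Finset.sum_eq_zero fun y hy => ?_
    obtain ⟨t, _, rfl⟩ := Finset.mem_image.1 hy
    rw [Finset.sum_congr rfl (g := fun _ => g t ^ k) (fun s hs => by
      rw [(Finset.mem_filter.1 hs).2]), Finset.sum_const]
    have : (Finset.univ.filter fun s => g s = g t).card = m := by
      rw [← h t, ← Set.ncard_coe_finset]
      exact congrArg _ (by ext; simp)
    rw [this, nsmul_eq_mul, hm0, zero_mul]

theorem hasFiberCard_shift {K : Type*} [Field K] {m : ℕ} {g g' : K → K} (h d : K)
    (hg : ∀ t, g (t + h) = g' t + d) :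
    HasFiberCard m g ↔ HasFiberCard m g' := by
  rw [← hasFiberCard_comp_equiv (Equiv.addRight h),
    ← hasFiberCard_comp_injective (g := g') (add_left_injective d)]
  simp only [Equiv.coe_addRight, hg]

end FiniteField

/-! ### Fibre sizes of cubic maps -/

section Cubic

variable {K : Type*} [Field K] [Fintype K]

theorem hasFiberCard_of_ker {K : Type*} [Field K] {g : K → K}
    (hg : ∀ s t, g (s + t) = g s + g t) {m n : ℕ} (hn : {t | g t = 0}.ncard = n) :
    HasFiberCard m g ↔ m = n :=
  HasFiberCard.iff_eq (hn ▸ (AddMonoidHom.mk' g hg).hasFiberCard_ker)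

theorem hasFiberCard_linear {m : ℕ} (γ : K) :
    HasFiberCard m (fun t => γ * t) ↔ (m = 1 ∧ γ ≠ 0) ∨ (m = Fintype.card K ∧ γ = 0) := by
  by_cases hγ : γ = 0
  · rw [hasFiberCard_of_ker (n := Fintype.card K) (fun s t => by ring)]
    · simp [hγ]
    · simp [hγ, Set.ncard_univ]
  · rw [HasFiberCard.iff_eq (mul_right_injective₀ hγ).hasFiberCard_one]
    simp [hγ]

theorem hasFiberCard_quadratic_of_two_eq_zero {K : Type*} [Field K] {m : ℕ} (h2 : (2 : K) = 0)
    {β : K} (hβ : β ≠ 0)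
    (γ : K) :
    HasFiberCard m (fun t => β * t ^ 2 + γ * t) ↔ (m = 1 ∧ γ = 0) ∨ (m = 2 ∧ γ ≠ 0) := by
  have hadd : ∀ s t : K, β * (s + t) ^ 2 + γ * (s + t) =
      (β * s ^ 2 + γ * s) + (β * t ^ 2 + γ * t) := by
    intro s t
    linear_combination β * s * t * h2
  have hker : {t : K | β * t ^ 2 + γ * t = 0} = {0, -γ / β} := by
    ext t
    simp only [Set.mem_ofPred_eq, Set.mem_insert_iff, Set.mem_singleton_iff]
    rw [eq_div_iff hβ, show β * t ^ 2 + γ * t = t * (t * β + γ) by ring, mul_eq_zero,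
      add_eq_zero_iff_eq_neg]
  by_cases hγ : γ = 0
  · rw [hasFiberCard_of_ker hadd (n := 1)]
    · simp [hγ]
    · rw [hker]; simp [hγ]
  · rw [hasFiberCard_of_ker hadd (n := 2)]
    · simp [hγ]
    · rw [hker, Set.ncard_pair]
      intro h
      rw [eq_comm, div_eq_zero_iff] at h
      simp_all

/-- After completing the square, 0 is alone in its fibre while 1 and -1 share one. -/
theorem not_hasFiberCard_quadratic {K : Type*} [Field K] {m : ℕ} (h2 : (2 : K) ≠ 0)
    {β : K} (hβ : β ≠ 0) (γ : K) :
    ¬ HasFiberCard m (fun t => β * t ^ 2 + γ * t) := by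
  rw [hasFiberCard_shift (-γ / (2 * β)) (-γ ^ 2 / (4 * β)) (g' := fun t => β * t ^ 2) (by
    intro t
    have h4 : (4 : K) = 2 * 2 := by norm_num
    rw [h4]
    field_simp
    ring)]
  intro h
  have h1 : m = 1 := by
    rw [← h 0, Set.ncard_eq_one]
    exact ⟨0, by ext t; simp [hβ]⟩
  subst h1
  have := h.injective (a₁ := 1) (a₂ := -1) (by simp)
  exact h2 (by linear_combination this)

/-- In characteristic 3 the map is additive. Its nonzero kernel elements satisfy (αt)² = -αγ, so
Euler's criterion decides between kernels of order 1 and 3. -/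
theorem hasFiberCard_cubic_of_three_eq_zero {m : ℕ} (h3 : (3 : K) = 0) {α : K} (hα : α ≠ 0)
    (γ : K) :
    HasFiberCard m (fun t => α * t ^ 3 + γ * t) ↔
      (m = 1 ∧ (-(α * γ)) ^ ((Fintype.card K - 1) / 2) ≠ 1) ∨
      (m = 3 ∧ (-(α * γ)) ^ ((Fintype.card K - 1) / 2) = 1) := by
  have hadd : ∀ s t : K, α * (s + t) ^ 3 + γ * (s + t) =
      (α * s ^ 3 + γ * s) + (α * t ^ 3 + γ * t) := by
    intro s t
    linear_combination α * s * t * (s + t) * h3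
  have h2 : (2 : K) ≠ 0 := fun h => one_ne_zero (α := K) (by linear_combination h3 - h)
  have hchar : ringChar K ≠ 2 := by
    intro h
    apply h2
    have := ringChar.Nat.cast_ringChar (R := K)
    rw [h] at this
    exact_mod_cast this
  have hodd := FiniteField.odd_card_of_char_ne_two hchar
  have hhalf : (Fintype.card K - 1) / 2 = Fintype.card K / 2 := by omega
  have hcard := Fintype.one_lt_card (α := K)
  have hmem : ∀ t : K, α * t ^ 3 + γ * t = 0 ↔ t = 0 ∨ (α * t) ^ 2 = -(α * γ) := by
    intro t
    rw [show α * t ^ 3 + γ * t = t * (α * t ^ 2 + γ) by ring, mul_eq_zero]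
    refine or_congr Iff.rfl ⟨fun h => by linear_combination α * h, fun h => ?_⟩
    apply mul_left_cancel₀ hα
    linear_combination h
  have hpow : ∀ c : K, c ≠ 0 → c ^ 2 = -(α * γ) →
      (-(α * γ)) ^ ((Fintype.card K - 1) / 2) = 1 := by
    intro c hc h
    rw [← h, hhalf]
    exact (FiniteField.isSquare_iff hchar (pow_ne_zero 2 hc)).1 ⟨c, sq c⟩
  by_cases hs : (-(α * γ)) ^ ((Fintype.card K - 1) / 2) = 1
  · rw [hasFiberCard_of_ker hadd (n := 3)]
    · simp [hs]
    · have h0 : -(α * γ) ≠ 0 := by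
        intro h
        rw [h, zero_pow (by omega)] at hs
        exact zero_ne_one hs
      obtain ⟨c, hc⟩ := (FiniteField.isSquare_iff hchar h0).2 (hhalf ▸ hs)
      have hc0 : c ≠ 0 := by
        rintro rfl
        exact h0 (by simpa using hc)
      rw [Set.ncard_eq_three]
      refine ⟨0, c / α, -(c / α), (div_ne_zero hc0 hα).symm,
        (neg_ne_zero.2 (div_ne_zero hc0 hα)).symm, ?_, ?_⟩
      · intro h
        have h' : 2 * (c / α) = 0 := by linear_combination h
        exact (mul_ne_zero h2 (div_ne_zero hc0 hα)) h'
      · ext t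
        simp only [Set.mem_ofPred_eq, Set.mem_insert_iff, Set.mem_singleton_iff]
        rw [hmem, hc, ← sq, sq_eq_sq_iff_eq_or_eq_neg, eq_div_iff hα, ← neg_div, eq_div_iff hα,
          mul_comm α]
  · rw [hasFiberCard_of_ker hadd (n := 1)]
    · simp [hs]
    · rw [Set.ncard_eq_one]
      refine ⟨0, ?_⟩
      ext t
      simp only [Set.mem_ofPred_eq, Set.mem_singleton_iff, hmem]
      constructor
      · rintro (h | h)
        · exact h
        · by_contra ht
          exact hs (hpow _ (mul_ne_zero hα ht) h)
      · exact Or.inl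

theorem not_hasFiberCard_cubic_of_three_eq_zero {m : ℕ} (h3 : (3 : K) = 0) (α : K) {β : K}
    (hβ : β ≠ 0) (γ : K) : ¬ HasFiberCard m (fun t => α * t ^ 3 + β * t ^ 2 + γ * t) := by
  have h2 : (2 : K) ≠ 0 := fun h => one_ne_zero (α := K) (by linear_combination h3 - h)
  have hcard := Fintype.one_lt_card (α := K)
  have hd2 : ¬ 2 ∣ Fintype.card K := fun h =>
    h2 (by exact_mod_cast (natCast_prime_eq_zero_iff_dvd_card (K := K) Nat.prime_two).2 h)
  -- Since 2 = -1, this shift completes the square, and on the cubic term it only adds a constant.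
  rw [hasFiberCard_shift (γ / β) (α * (γ / β) ^ 3 + 2 * γ ^ 2 / β)
    (g' := fun t => α * t ^ 3 + β * t ^ 2) (by
      intro t
      field_simp
      linear_combination (α * t ^ 2 * β ^ 2 * γ + α * t * β * γ ^ 2 + t * β ^ 3 * γ) * h3)]
  intro h
  have hsum := h.sum_pow_eq_zero (k := (Fintype.card K - 1) / 2) (by omega)
  -- The exponents start at `Fintype.card K - 1`, so only the lowest term, a power of β, survives.
  rw [sum_binomial_pow α β (j₀ := 0) (by norm_num) (by norm_num) (by omega) (by omega) (by omega)
    (by omega)] at hsum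
  simp only [Nat.choose_zero_right, Nat.cast_one, pow_zero, mul_one, one_mul, neg_eq_zero] at hsum
  exact pow_ne_zero _ hβ hsum

theorem injective_pow_three (hq : Fintype.card K % 3 = 2) :
    Function.Injective (fun t : K => t ^ 3) := by
  intro s t hst
  obtain ⟨k, hk⟩ : ∃ k, Fintype.card K = 3 * k + 2 := ⟨Fintype.card K / 3, by omega⟩
  -- Cubing is inverted by the exponent 2k + 1, because 3(2k + 1) = 2(3k + 1) + 1.
  have key : ∀ t : K, (t ^ 3) ^ (2 * k + 1) = t := by
    intro t
    have h := FiniteField.pow_card t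
    rw [hk] at h
    calc (t ^ 3) ^ (2 * k + 1) = t ^ (3 * k + 2) * t ^ (3 * k + 1) := by ring
      _ = t * t ^ (3 * k + 1) := by rw [h]
      _ = t ^ (3 * k + 2) := by ring
      _ = t := h
  rw [← key s, ← key t]
  exact congrArg (· ^ (2 * k + 1)) hst

theorem hasFiberCard_cubic_depressed {m : ℕ} (hcard : 4 < Fintype.card K) (h3 : (3 : K) ≠ 0)
    {α : K} (hα : α ≠ 0) (γ : K) :
    HasFiberCard m (fun t => α * t ^ 3 + γ * t) ↔
      m = 1 ∧ Fintype.card K ≡ 2 [MOD 3] ∧ γ = 0 := by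
  have hd3 : ¬ 3 ∣ Fintype.card K := fun h =>
    h3 (by exact_mod_cast (natCast_prime_eq_zero_iff_dvd_card (K := K) Nat.prime_three).2 h)
  by_cases hq : Fintype.card K % 3 = 2
  · have hinj : γ = 0 → Function.Injective (fun t => α * t ^ 3 + γ * t) := by
      rintro rfl s t h
      exact injective_pow_three hq (mul_left_cancel₀ hα (by simpa using h))
    constructor
    · intro h
      have hγ : γ = 0 := by
        obtain ⟨k, hk⟩ : ∃ k, Fintype.card K = 3 * k + 2 := ⟨Fintype.card K / 3, by omega⟩
        -- Using k cubic factors and one linear factor gives degree 3k + 1, so the sum isolates γ.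
        have hsum := h.sum_pow_eq_zero (k := k + 1) (by omega)
        have e1 : ∀ t : K, α * t ^ 3 + γ * t = α * t ^ 3 + γ * t ^ 1 := fun t => by rw [pow_one]
        simp_rw [e1] at hsum
        rw [sum_binomial_pow α γ (j₀ := k) (by norm_num) (by norm_num) (by omega) (by omega)
          (by omega) (by omega), Nat.choose_succ_self_right, Nat.add_sub_cancel_left, pow_one,
          neg_eq_zero] at hsum
        -- In `K`, 3(k + 1) is the order of `K` plus 1, hence equals 1.
        have hk1 : ((k + 1 : ℕ) : K) ≠ 0 := by
          intro h
          have hc := FiniteField.cast_card_eq_zero K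
          rw [hk] at hc
          push_cast at h hc
          exact one_ne_zero (α := K) (by linear_combination 3 * h - hc)
        simpa [hk1, hα] using (mul_eq_zero.1 hsum).resolve_left
          (mul_ne_zero hk1 (pow_ne_zero _ hα))
      exact ⟨h.unique (hinj hγ).hasFiberCard_one, hq, hγ⟩
    · rintro ⟨rfl, -, hγ⟩
      exact (hinj hγ).hasFiberCard_one
  · constructor
    · intro h
      exfalso
      obtain ⟨k, hk⟩ : ∃ k, Fintype.card K = 3 * k + 1 := ⟨Fintype.card K / 3, by omega⟩
      -- Here 3k is itself `Fintype.card K - 1`, so the leading term survives.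
      have hsum := h.sum_pow_eq_zero (k := k) (by omega)
      have e1 : ∀ t : K, α * t ^ 3 + γ * t = α * t ^ 3 + γ * t ^ 1 := fun t => by rw [pow_one]
      simp_rw [e1] at hsum
      rw [sum_binomial_pow α γ (j₀ := k) (by norm_num) (by norm_num) (by omega) (by omega)
        (by omega) (by omega)] at hsum
      simp [hα] at hsum
    · rintro ⟨-, h, -⟩
      exact absurd h hq

theorem hasFiberCard_cubic_of_three_ne_zero {m : ℕ} (hcard : 4 < Fintype.card K)
    (h3 : (3 : K) ≠ 0) {α : K} (hα : α ≠ 0) (β γ : K) :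
    HasFiberCard m (fun t => α * t ^ 3 + β * t ^ 2 + γ * t) ↔
      m = 1 ∧ Fintype.card K ≡ 2 [MOD 3] ∧ β ^ 2 = 3 * (α * γ) := by
  rw [hasFiberCard_shift (-β / (3 * α))
    (α * (-β / (3 * α)) ^ 3 + β * (-β / (3 * α)) ^ 2 + γ * (-β / (3 * α)))
    (g' := fun t => α * t ^ 3 + (γ - β ^ 2 / (3 * α)) * t) (by
      intro t
      field_simp
      ring), hasFiberCard_cubic_depressed hcard h3 hα]
  refine and_congr_right' (and_congr_right' ?_)
  rw [sub_eq_zero, eq_div_iff (mul_ne_zero h3 hα), eq_comm]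
  ring_nf

/-- The fibre sizes of a cubic polynomial map on a finite field with more than four elements. -/
theorem hasFiberCard_cubic {m : ℕ} (hcard : 4 < Fintype.card K) (α β γ δ : K) :
    HasFiberCard m (fun t => α * t ^ 3 + β * t ^ 2 + γ * t + δ) ↔
      (m = 1 ∧ α = 0 ∧ β = 0 ∧ γ ≠ 0) ∨
      (m = 1 ∧ 2 ∣ Fintype.card K ∧ α = 0 ∧ β ≠ 0 ∧ γ = 0) ∨
      (m = 1 ∧ Fintype.card K ≡ 2 [MOD 3] ∧ α ≠ 0 ∧ β ^ 2 = 3 * (α * γ)) ∨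
      (m = 1 ∧ 3 ∣ Fintype.card K ∧ α ≠ 0 ∧ β = 0 ∧
        (-(α * γ)) ^ ((Fintype.card K - 1) / 2) ≠ 1) ∨
      (m = 2 ∧ 2 ∣ Fintype.card K ∧ α = 0 ∧ β ≠ 0 ∧ γ ≠ 0) ∨
      (m = 3 ∧ 3 ∣ Fintype.card K ∧ α ≠ 0 ∧ β = 0 ∧
        (-(α * γ)) ^ ((Fintype.card K - 1) / 2) = 1) ∨
      (m = Fintype.card K ∧ α = 0 ∧ β = 0 ∧ γ = 0) := by
  have h2 := natCast_prime_eq_zero_iff_dvd_card (K := K) Nat.prime_two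
  have h3 := natCast_prime_eq_zero_iff_dvd_card (K := K) Nat.prime_three
  rw [Nat.cast_ofNat] at h2 h3
  rw [hasFiberCard_comp_injective (g := fun t => α * t ^ 3 + β * t ^ 2 + γ * t)
    (add_left_injective δ)]
  by_cases hα : α = 0
  · subst hα
    simp only [zero_mul, zero_add]
    by_cases hβ : β = 0
    · subst hβ
      simp only [zero_mul, zero_add]
      rw [hasFiberCard_linear]
      simp
    · by_cases h2' : (2 : K) = 0
      · rw [hasFiberCard_quadratic_of_two_eq_zero h2' hβ]
        simp [hβ, h2.1 h2']
      · have hd2 : ¬ 2 ∣ Fintype.card K := fun h => h2' (h2.2 h)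
        simp [hβ, hd2, not_hasFiberCard_quadratic h2' hβ]
  · by_cases h3' : (3 : K) = 0
    · have hd3 := h3.1 h3'
      have hmod : ¬ Fintype.card K ≡ 2 [MOD 3] := by
        intro h
        have : Fintype.card K % 3 = 2 := h
        omega
      by_cases hβ : β = 0
      · subst hβ
        simp only [zero_mul, add_zero]
        rw [hasFiberCard_cubic_of_three_eq_zero h3' hα]
        simp [hα, hd3, hmod]
      · simp [hα, hβ, hmod, not_hasFiberCard_cubic_of_three_eq_zero h3' α hβ γ]
    · rw [hasFiberCard_cubic_of_three_ne_zero hcard h3' hα]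
      have hd3 : ¬ 3 ∣ Fintype.card K := fun h => h3' (h3.2 h)
      simp [hα, hd3]

end Cubic

/-! ### Counting preimages and linearized maps -/

/-- With S the set of values having m preimages under `g`, exactly q·#S elements have m preimages
under `f`. The required number forces m·#S = q, so the fibres over S already exhaust `K`. -/
theorem isManyToOne_iff_hasFiberCard {F K : Type*} [Finite F] [Fintype K] {q m : ℕ}
    (hF : Nat.card F = q ^ 2) (hK : Fintype.card K = q) (hm : 1 ≤ m) (hmq : m ≤ q)
    {f : F → F} {g : K → K} {p : F → K} (hp : ∀ s, (p ⁻¹' {s}).ncard = q)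
    (hfib : ∀ w, (f ⁻¹' {w}).ncard = (g ⁻¹' {p w}).ncard) :
    IsManyToOne m f ↔ HasFiberCard m g := by
  classical
  have := Fintype.ofFinite F
  have hq : 0 < q := by omega
  set W : Finset F := Finset.univ.filter fun w => (f ⁻¹' {w}).ncard = m with hW
  set S : Finset K := Finset.univ.filter fun s => (g ⁻¹' {s}).ncard = m with hS
  have hWS : W.card = q * S.card := by
    rw [Finset.card_eq_sum_card_fiberwise (f := p) (t := S)]
    · rw [Finset.sum_congr rfl (g := fun _ => q), Finset.sum_const, smul_eq_mul, mul_comm]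
      intro s hs
      rw [← hp s, ← Set.ncard_coe_finset]
      congr 1
      ext w
      simp only [hW, hfib, Finset.coe_filter, Finset.mem_filter, Finset.mem_univ, true_and,
        Set.mem_ofPred_eq, Set.mem_preimage, Set.mem_singleton_iff, and_iff_right_iff_imp]
      rintro rfl
      exact (Finset.mem_filter.1 hs).2
    · intro w hw
      simpa [hW, hS, hfib] using hw
  have hsum : ∑ s : K, (g ⁻¹' {s}).ncard = q := by
    rw [← hK, ← Finset.card_univ, Finset.card_eq_sum_card_fiberwise (f := g) (t := Finset.univ)
      (by simp)]
    refine Finset.sum_congr rfl fun s _ => ?_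
    rw [← Set.ncard_coe_finset]
    congr 1
    ext
    simp
  have hSsum : ∑ s ∈ S, (g ⁻¹' {s}).ncard = S.card * m := by
    rw [Finset.sum_congr rfl (g := fun _ => m), Finset.sum_const, smul_eq_mul]
    intro s hs
    exact (Finset.mem_filter.1 hs).2
  have hsplit : S.card * m + ∑ s ∈ Sᶜ, (g ⁻¹' {s}).ncard = q := by
    rw [← hSsum, Finset.sum_add_sum_compl, hsum]
  constructor
  · rintro ⟨-, -, T, hT, hTm⟩
    have hTW : T.card ≤ W.card := Finset.card_le_card fun y hy => by
      simp [hW, hTm y hy]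
    have hSq : S.card * m = q := by
      rw [hT, hF, hWS] at hTW
      have h1 := Nat.div_add_mod (q ^ 2) m
      have h2 := Nat.mod_lt (q ^ 2) hm
      have h3 : q ^ 2 < q * (S.card * m) + m := by
        have := Nat.mul_le_mul_left m hTW
        have e : m * (q * S.card) = q * (S.card * m) := by ring
        omega
      -- If m·#S ≤ q - 1, then q·m·#S + m ≤ q² - q + m ≤ q² because m ≤ q, against `h3`.
      by_contra hne
      have h4 : S.card * m + 1 ≤ q := by omega
      have := Nat.mul_le_mul_left q h4
      have e : q ^ 2 = q * q := sq q
      rw [mul_add] at this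
      omega
    have hzero : ∀ s ∈ Sᶜ, (g ⁻¹' {s}).ncard = 0 := by
      rw [← Finset.sum_eq_zero_iff]
      omega
    intro t
    by_contra hne
    have ht : g t ∈ Sᶜ := by simpa [hS] using hne
    have h0 := hzero _ ht
    rw [Set.ncard_eq_zero] at h0
    exact Set.notMem_empty t (h0 ▸ (rfl : g t = g t))
  · intro h
    have hzero : ∀ s ∈ Sᶜ, (g ⁻¹' {s}).ncard = 0 := by
      intro s hs
      rw [Set.ncard_eq_zero, Set.eq_empty_iff_forall_notMem]
      rintro t rfl
      simp [hS, h t] at hs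
    rw [Finset.sum_eq_zero hzero, add_zero] at hsplit
    refine ⟨hm, by rw [hF]; nlinarith, W, ?_, ?_⟩
    · rw [hWS, hF]
      symm
      apply Nat.div_eq_of_eq_mul_left (by omega)
      rw [mul_assoc, hsplit, sq]
    · intro y hy
      exact (Finset.mem_filter.1 hy).2

/-- Kernel and image orders are each at most q with product q², so both bounds are equalities. -/
theorem AddMonoidHom.card_eq_of_card_ker_le {G H : Type*} [AddGroup G] [AddGroup H] [Finite G]
    [Finite H] {q : ℕ} (hq : 0 < q) (hG : Nat.card G = q ^ 2) (hH : Nat.card H ≤ q)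
    (h : G →+ H) (hk : Nat.card h.ker ≤ q) :
    Nat.card H = q ∧ Function.Surjective h ∧ ∀ s, (h ⁻¹' {s}).ncard = q := by
  have h1 : Nat.card h.ker * Nat.card h.range = q ^ 2 := by
    rw [← hG, ← AddSubgroup.index_ker h, AddSubgroup.card_mul_index]
  have h2 : Nat.card h.range ≤ Nat.card H := AddSubgroup.card_le_card_addGroup _
  have h3 : Nat.card h.ker = q := by
    by_contra hne
    have : Nat.card h.ker + 1 ≤ q := by omega
    nlinarith
  have h4 : Nat.card h.range = q := by
    rw [h3, sq] at h1
    exact Nat.eq_of_mul_eq_mul_left hq h1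
  have h5 : Nat.card H = q := by omega
  have hsurj : Function.Surjective h := by
    rw [← AddMonoidHom.range_eq_top]
    exact AddSubgroup.eq_top_of_card_eq _ (h4.trans h5.symm)
  refine ⟨h5, hsurj, fun s => ?_⟩
  obtain ⟨t, rfl⟩ := hsurj s
  rw [h.hasFiberCard_ker t, h3]

theorem ncard_linearized_roots_le {F : Type*} [Field F] {q : ℕ} (hq : 2 ≤ q) {c : F}
    (hc : c ≠ 0) (d : F) : {x : F | c * x ^ q + d * x = 0}.ncard ≤ q := by
  classical
  set p : F[X] := C c * X ^ q + C d * X with hp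
  have hdeg : p.natDegree = q := by
    rw [hp, natDegree_add_eq_left_of_natDegree_lt, natDegree_C_mul_X_pow _ _ hc]
    rw [natDegree_C_mul_X_pow _ _ hc]
    exact (natDegree_C_mul_le d X).trans_lt (by rw [natDegree_X]; omega)
  have hp0 : p ≠ 0 := by
    intro h
    rw [h, natDegree_zero] at hdeg
    omega
  have : {x : F | c * x ^ q + d * x = 0} = (p.roots.toFinset : Set F) := by
    ext x
    simp only [Set.mem_ofPred_eq, SetLike.mem_coe, Multiset.mem_toFinset, mem_roots hp0]
    simp [hp]
  rw [this, Set.ncard_coe_finset]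
  exact (Multiset.toFinset_card_le _).trans ((card_roots' p).trans hdeg.le)

/-- As q divides a prime power, it is a power of the characteristic, so `x ↦ x ^ q` is an iterated
Frobenius. -/
theorem exists_ringHom_eq_pow {F : Type*} [Field F] [Finite F] {q : ℕ}
    (hF : Nat.card F = q ^ 2) : ∃ φ : F →+* F, (∀ x, x ^ q = φ x) ∧ ∀ x, φ (φ x) = x := by
  have := Fintype.ofFinite F
  obtain ⟨p, _, n, hp, hn⟩ := FiniteField.card' F
  have := Fact.mk hp
  rw [Nat.card_eq_fintype_card] at hF
  obtain ⟨k, -, rfl⟩ := (Nat.dvd_prime_pow hp).1 (hn ▸ hF ▸ dvd_pow_self q two_ne_zero)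
  refine ⟨iterateFrobenius F p k, fun x => (iterateFrobenius_def ..).symm, fun x => ?_⟩
  rw [iterateFrobenius_def, iterateFrobenius_def, ← pow_mul, ← sq, ← hF, FiniteField.pow_card]

section Reduction

variable {F : Type*} [Field F] {φ : F →+* F}

/-- The additive map `x ↦ (a φ(x) + b x) / τ`, viewed as a map to the fixed field of `φ`. -/
noncomputable def scaledLinearized (φ : F →+* F) (a b τ : F)
    (hτ : ∀ x, φ ((a * φ x + b * x) / τ) = (a * φ x + b * x) / τ) :
    F →+ φ.eqLocusField (RingHom.id F) where
  toFun x := ⟨(a * φ x + b * x) / τ, hτ x⟩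
  map_zero' := by ext; simp
  map_add' x y := by ext; simp; ring

theorem card_fixedField_le [Finite F] {q : ℕ} (hq : 2 ≤ q) (hφ : ∀ x, x ^ q = φ x) :
    Nat.card (φ.eqLocusField (RingHom.id F)) ≤ q := by
  refine le_trans (le_of_eq ?_) (ncard_linearized_roots_le hq (one_ne_zero (α := F)) (-1))
  rw [← Nat.card_coe_set_eq]
  refine Nat.card_congr (Equiv.subtypeEquivRight fun x => ?_)
  rw [RingHom.mem_eqLocusField, RingHom.id_apply, Set.mem_ofPred_eq, hφ]
  rw [← sub_eq_zero]
  ring_nf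

theorem scaledLinearized_fibers [Finite F] {q : ℕ} (hq : 2 ≤ q) (hF : Nat.card F = q ^ 2)
    (hφ : ∀ x, x ^ q = φ x) {a b τ : F} (hτ0 : τ ≠ 0) (ha : a ≠ 0)
    {h : F →+ φ.eqLocusField (RingHom.id F)} (hh : ∀ x, (h x : F) = (a * φ x + b * x) / τ) :
    Nat.card (φ.eqLocusField (RingHom.id F)) = q ∧ Function.Surjective h ∧
      ∀ s, (h ⁻¹' {s}).ncard = q := by
  refine AddMonoidHom.card_eq_of_card_ker_le (by omega) hF (card_fixedField_le hq hφ) h ?_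
  refine le_trans (le_of_eq ?_) (ncard_linearized_roots_le hq ha b)
  rw [← Nat.card_coe_set_eq]
  refine Nat.card_congr (Equiv.subtypeEquivRight fun x => ?_)
  rw [AddMonoidHom.mem_ker, ← ZeroMemClass.coe_eq_zero, hh, div_eq_zero_iff, or_iff_left hτ0,
    Set.mem_ofPred_eq, hφ]

end Reduction

/-! ### Reduction to a cubic over the fixed field -/

/-- The map `x ↦ Y x + u φ(x) + v x` has constant fibre size exactly in the seven cases, when `Y`
factors through `x ↦ a φ(x) + b x` and `B Y + A φ(Y)` is the cubic form given by `P` and `Q`. -/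
theorem isManyToOne_iff_sevenCases {F : Type*} [Field F] [Finite F] {φ : F →+* F} {q m : ℕ}
    (hq : 7 ≤ q) (hF : Nat.card F = q ^ 2) (hφ : ∀ x, x ^ q = φ x) (hφφ : ∀ x, φ (φ x) = x)
    (hm : 1 ≤ m) (hmq : m ≤ q) {a b c u v A B P Q : F}
    (hab : a * φ a = b * φ b) (huv : a * v ≠ b * u)
    (hA : A = b * u - a * v) (hB : B = a * φ u - b * φ v)
    (hP : b * φ P = φ a * Q) (hQ : b * φ Q = φ a * P) (hP0 : P ≠ 0)
    {Y : F → F} (hY : ∀ x, B * Y x + A * φ (Y x) =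
      (a * φ x + b * x + c) * φ (a * φ x + b * x + c) *
        (P * (a * φ x + b * x + c) + Q * φ (a * φ x + b * x + c)))
    (hYL : ∀ x x', a * φ x + b * x = a * φ x' + b * x' → Y x = Y x')
    {α β γ : F} (hα : α = P + φ P)
    (hβ : β = (2 * φ a * c + b * φ c) * P + (φ a * c + 2 * b * φ c) * φ P)
    (hγ : γ = 2 * α * (c * φ c) + Q * φ c ^ 2 + φ Q * c ^ 2 + u * φ u - v * φ v) :
    IsManyToOne m (fun x => Y x + u * φ x + v * x) ↔ SevenCases q m a b c u v α β γ := by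
  have ha : a ≠ 0 := by
    rintro rfl
    have : b = 0 := by simpa using hab.symm
    exact huv (by rw [this]; ring)
  have hb : b ≠ 0 := by
    rintro rfl
    exact ha (by simpa using hab)
  have hφ0 : ∀ {x : F}, x ≠ 0 → φ x ≠ 0 := fun h => (map_ne_zero φ).2 h
  have hA0 : A ≠ 0 := by
    rw [hA]
    exact sub_ne_zero.2 (Ne.symm huv)
  have hbA : b * φ A = φ a * B := by
    rw [hA, hB, map_sub, map_mul, map_mul]
    linear_combination -φ u * hab
  have hbB : b * φ B = φ a * A := by
    rw [hA, hB, map_sub, map_mul, map_mul, hφφ, hφφ]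
    linear_combination v * hab
  set e : F := φ a / b with he
  have heb : e * b = φ a := div_mul_cancel₀ _ hb
  have he0 : e ≠ 0 := div_ne_zero (hφ0 ha) hb
  have hee : φ e * e = 1 := by
    rw [he, map_div₀, hφφ]
    have := hφ0 hb
    field_simp
    linear_combination hab
  have hφP : φ P = e * Q := mul_left_cancel₀ hb (by linear_combination hP - Q * heb)
  have hφQ : φ Q = e * P := mul_left_cancel₀ hb (by linear_combination hQ - P * heb)
  have hφA : φ A = e * B := mul_left_cancel₀ hb (by linear_combination hbA - B * heb)
  have hφB : φ B = e * A := mul_left_cancel₀ hb (by linear_combination hbB - A * heb)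
  have hL : ∀ x, φ (a * φ x + b * x) = e * (a * φ x + b * x) := by
    intro x
    rw [map_add, map_mul, map_mul, hφφ]
    apply mul_left_cancel₀ hb
    linear_combination -(a * φ x + b * x) * heb - φ x * hab
  obtain ⟨x₀, hx₀⟩ : ∃ x, a * φ x + b * x ≠ 0 := by
    by_contra! h
    have h1 := ncard_linearized_roots_le (show 2 ≤ q by omega) ha b
    have h2 : {x : F | a * x ^ q + b * x = 0} = Set.univ := by
      ext x; simp [hφ, h x]
    rw [h2, Set.ncard_univ, hF] at h1
    nlinarith
  set τ := a * φ x₀ + b * x₀ with hτ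
  have hφτ : φ τ = e * τ := hL x₀
  have hfix : ∀ z, φ z = e * z → φ (z / τ) = z / τ := by
    intro z hz
    rw [map_div₀, hz, hφτ, mul_div_mul_left _ _ he0]
  have hpi : ∀ w, φ (A * φ w + B * w) = e * (A * φ w + B * w) := by
    intro w
    rw [map_add, map_mul, map_mul, hφφ, hφA, hφB]
    ring
  set K := φ.eqLocusField (RingHom.id F)
  obtain ⟨lam, hlamx⟩ : ∃ lam : F →+ K, ∀ x, (lam x : F) = (a * φ x + b * x) / τ :=
    ⟨scaledLinearized φ a b τ fun x => hfix _ (hL x), fun _ => rfl⟩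
  obtain ⟨p, hpx⟩ : ∃ p : F →+ K, ∀ x, (p x : F) = (A * φ x + B * x) / τ :=
    ⟨scaledLinearized φ A B τ fun x => hfix _ (hpi x), fun _ => rfl⟩
  obtain ⟨hK, hlams, -⟩ := scaledLinearized_fibers (by omega) hF hφ hx₀ ha hlamx
  obtain ⟨-, -, hpfib⟩ := scaledLinearized_fibers (by omega) hF hφ hx₀ hA0 hpx
  have hφe : φ e = e⁻¹ := eq_inv_of_mul_eq_one_left hee
  have hαfix : φ α = α := by rw [hα, map_add, hφφ, add_comm]
  have hφα : α = P + e * Q := by rw [hα, hφP]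
  have hβb : β = b * ((2 * e * c + φ c) * P + (e * c + 2 * φ c) * (e * Q)) := by
    rw [hβ, ← hφP, ← heb]; ring
  set D := u * φ u - v * φ v with hD
  have hφD : φ D = D := by
    rw [hD, map_sub, map_mul, map_mul, hφφ, hφφ]; ring
  have hφγ : γ = 2 * α * (c * φ c) + Q * φ c ^ 2 + e * P * c ^ 2 + D := by
    rw [hγ, hφQ, hD]; ring
  -- The coefficients of `g` arise by putting τt for `a * φ x + b * x` in the cubic form and
  -- dividing by τ. Each must be fixed by `φ` to lie in `K`.
  have h1 : φ (e * α * τ ^ 2) = e * α * τ ^ 2 := by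
    rw [map_mul, map_mul, map_pow, hφe, hφτ, hαfix]
    field_simp
  have h2 : φ (β / b * τ) = β / b * τ := by
    rw [hβb, mul_div_cancel_left₀ _ hb]
    simp only [map_mul, map_add, map_ofNat, hφφ, hφe, hφτ, hφP, hφQ]
    field_simp
    ring
  have h3 : φ γ = γ := by
    rw [hφγ]
    simp only [map_mul, map_add, map_ofNat, map_pow, hφφ, hφe, hφD, hφP, hφQ, hαfix]
    field_simp
    ring
  have h4 : φ ((P * c + Q * φ c) * (c * φ c) / τ) = (P * c + Q * φ c) * (c * φ c) / τ := by
    simp only [map_div₀, map_mul, map_add, hφφ, hφτ, hφP, hφQ]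
    field_simp
    ring
  set α₁ : K := ⟨_, h1⟩ with hα₁
  set β₁ : K := ⟨_, h2⟩ with hβ₁
  set γ₁ : K := ⟨_, h3⟩ with hγ₁
  set δ₁ : K := ⟨_, h4⟩ with hδ₁
  set g : K → K := fun t => α₁ * t ^ 3 + β₁ * t ^ 2 + γ₁ * t + δ₁ with hg
  have hN : ∀ x, B * (u * φ x + v * x) + A * φ (u * φ x + v * x) = D * (a * φ x + b * x) := by
    intro x
    rw [map_add, map_mul, map_mul, hφφ, hA, hB, hD]
    ring
  have hpf : ∀ x, p (Y x + u * φ x + v * x) = g (lam x) := by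
    intro x
    ext
    have e1 : A * φ (Y x + u * φ x + v * x) + B * (Y x + u * φ x + v * x) =
        (B * Y x + A * φ (Y x)) + (B * (u * φ x + v * x) + A * φ (u * φ x + v * x)) := by
      rw [add_assoc (Y x), map_add φ (Y x)]; ring
    have e2 : ((g (lam x) : K) : F) = e * α * τ ^ 2 * ((a * φ x + b * x) / τ) ^ 3 +
        β / b * τ * ((a * φ x + b * x) / τ) ^ 2 + γ * ((a * φ x + b * x) / τ) +
        (P * c + Q * φ c) * (c * φ c) / τ := by
      simp [hg, hα₁, hβ₁, hγ₁, hδ₁, hlamx]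
    rw [hpx, e1, hY, hN, e2, map_add φ (a * φ x + b * x), hL, hβb, hφγ, hφα,
      mul_div_cancel_left₀ _ hb]
    generalize a * φ x + b * x = l
    field_simp
    ring
  have hB0 : B ≠ 0 := by
    rintro rfl
    exact hφ0 hA0 (by rw [hφA, mul_zero])
  have hlam_eq : ∀ x x', lam x = lam x' ↔ a * φ x + b * x = a * φ x' + b * x' := by
    intro x x'
    rw [← Subtype.coe_inj, hlamx, hlamx, div_left_inj' hx₀]
  have hfib : ∀ w, ((fun x => Y x + u * φ x + v * x) ⁻¹' {w}).ncard = (g ⁻¹' {p w}).ncard := by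
    intro w
    have himage : g ⁻¹' {p w} = lam '' ((fun x => Y x + u * φ x + v * x) ⁻¹' {w}) := by
      ext t
      simp only [Set.mem_preimage, Set.mem_singleton_iff, Set.mem_image]
      constructor
      · intro ht
        obtain ⟨x₁, rfl⟩ := hlams t
        set w' := w - (Y x₁ + u * φ x₁ + v * x₁) with hw'
        have hker : A * φ w' + B * w' = 0 := by
          have hz : p w' = 0 := by rw [hw', map_sub, hpf, ht, sub_self]
          rw [← ZeroMemClass.coe_eq_zero, hpx, div_eq_zero_iff] at hz
          exact hz.resolve_right hx₀
        -- Cramer's rule for `a * φ z + b * z = 0`, `u * φ z + v * z = w'`, with determinant -A. The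
        -- values found for z and `φ z` are compatible precisely because `p w' = 0`.
        set z := -(a * w') / A with hz
        have hφz : φ z = b * w' / A := by
          rw [hz, map_div₀, map_neg, map_mul, hφA, ← heb]
          field_simp
          linear_combination -hker
        have hz0 : a * φ z + b * z = 0 := by
          rw [hφz, hz]
          ring
        have hzN : u * φ z + v * z = w' := by
          rw [hφz, hz]
          field_simp
          rw [hA]
          ring
        have hLz : a * φ (x₁ + z) + b * (x₁ + z) = a * φ x₁ + b * x₁ := by
          rw [map_add]
          linear_combination hz0
        refine ⟨x₁ + z, ?_, (hlam_eq _ _).2 hLz⟩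
        rw [hYL _ _ hLz, map_add]
        linear_combination hzN + hw'
      · rintro ⟨x, rfl, rfl⟩
        exact (hpf x).symm
    rw [himage, Set.InjOn.ncard_image]
    intro x hx x' hx' h
    have hl := (hlam_eq x x').1 h
    have hf : Y x + u * φ x + v * x = Y x' + u * φ x' + v * x' := hx.trans hx'.symm
    rw [hYL x x' hl] at hf
    apply mul_left_cancel₀ hA0
    rw [hA]
    linear_combination u * hl - a * hf
  have := Fintype.ofFinite K
  have hKq : Fintype.card K = q := by rw [← Nat.card_eq_fintype_card, hK]
  rw [isManyToOne_iff_hasFiberCard hF hKq hm hmq hpfib hfib, hg,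
    hasFiberCard_cubic (by omega), hKq]
  have cα : α₁ = 0 ↔ α = 0 := by
    rw [← ZeroMemClass.coe_eq_zero]
    simp [hα₁, he0, hx₀]
  have cβ : β₁ = 0 ↔ β = 0 := by
    rw [← ZeroMemClass.coe_eq_zero]
    simp [hβ₁, hb, hx₀]
  have cγ : γ₁ = 0 ↔ γ = 0 := by
    rw [← ZeroMemClass.coe_eq_zero]
  -- If α = 0 then `φ P = -P`, and β factors through P.
  have cβ' : α = 0 → (β = 0 ↔ φ a * c = b * φ c) := by
    intro h0
    have e1 : β = (φ a * c - b * φ c) * P := by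
      rw [hβ]
      linear_combination (φ a * c + 2 * b * φ c) * (h0 - hα)
    rw [e1, mul_eq_zero, or_iff_left hP0, sub_eq_zero]
  have cγ' : α = 0 → φ a * c = b * φ c → γ = D := by
    intro h0 h
    have e1 : Q * φ c ^ 2 + φ Q * c ^ 2 = 0 := by
      have : b ^ 2 * (Q * φ c ^ 2 + φ Q * c ^ 2) = 0 := by
        linear_combination -(Q * (φ a * c + b * φ c)) * h - φ a * c ^ 2 * hP + b * c ^ 2 * hQ
          + b * φ a * c ^ 2 * (h0 - hα)
      exact (mul_eq_zero.1 this).resolve_left (pow_ne_zero 2 hb)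
    rw [hγ, hD]
    linear_combination e1 + 2 * c * φ c * h0
  have csq : β₁ ^ 2 = 3 * (α₁ * γ₁) ↔ β ^ 2 = 3 * a ^ q * b * α * γ := by
    rw [← Subtype.coe_inj, hφ]
    have e1 : ((β₁ ^ 2 : K) : F) = (β / b * τ) ^ 2 := by simp [hβ₁]
    have e2 : ((3 * (α₁ * γ₁) : K) : F) = 3 * (e * α * τ ^ 2 * γ) := rfl
    rw [e1, e2, ← heb]
    constructor
    · intro h
      field_simp at h
      linear_combination h
    · intro h
      field_simp
      linear_combination h
  have cpow : 3 ∣ q → ((-(α₁ * γ₁)) ^ ((q - 1) / 2) = 1 ↔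
      (-(α * γ)) ^ ((q - 1) / 2) = (a * (b ^ q)⁻¹) ^ ((q + 1) / 2)) := by
    intro hq3
    have hq2 : ¬ 2 ∣ q := by
      intro hq2
      rw [← hKq] at hq2 hq3
      have h2 := (natCast_prime_eq_zero_iff_dvd_card (K := K) Nat.prime_two).2 hq2
      have h3 := (natCast_prime_eq_zero_iff_dvd_card (K := K) Nat.prime_three).2 hq3
      push_cast at h2 h3
      exact one_ne_zero (α := K) (by linear_combination h3 - h2)
    obtain ⟨k, hk⟩ : ∃ k, q = 2 * k + 1 := ⟨q / 2, by omega⟩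
    rw [show (q - 1) / 2 = k by omega, show (q + 1) / 2 = k + 1 by omega, hφ]
    -- From `φ τ = e * τ` comes `τ ^ (q - 1) = e`. This turns the Euler criterion for `g` into the
    -- condition with exponent (q + 1)/2, as `e⁻¹ = a * (φ b)⁻¹`.
    have hτk : (τ ^ 2) ^ k = e := by
      apply mul_right_cancel₀ hx₀
      rw [← hφτ, ← hφ τ, hk, ← pow_mul, ← pow_succ]
    have hinv : a * (φ b)⁻¹ = e⁻¹ := by
      rw [he, inv_div]
      have := hφ0 ha
      have := hφ0 hb
      field_simp
      linear_combination hab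
    have e1 : (((-(α₁ * γ₁)) ^ k : K) : F) = (-(α * γ)) ^ k * e ^ (k + 1) := by
      have : (((-(α₁ * γ₁)) ^ k : K) : F) = (-(e * α * τ ^ 2 * γ)) ^ k := by
        simp [hα₁, hγ₁]
      rw [this, show -(e * α * τ ^ 2 * γ) = -(α * γ) * e * τ ^ 2 by ring, mul_pow, hτk,
        mul_pow, pow_succ]
      ring
    rw [← Subtype.coe_inj, e1, hinv, inv_pow, ← mul_eq_one_iff_eq_inv₀ (pow_ne_zero _ he0)]
    rfl
  rw [SevenCases, csq, hφ a, hφ c, pow_succ u, pow_succ v, hφ u, hφ v, mul_comm (φ u),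
    mul_comm (φ v)]
  simp only [Ne, cα, cβ, cγ]
  refine or_congr ?_ (or_congr ?_ (or_congr ?_ (or_congr ?_ (or_congr ?_ (or_congr ?_ ?_)))))
  · refine and_congr_right' (and_congr_right fun h0 => ?_)
    rw [cβ' h0]
    refine and_congr_right fun h => ?_
    rw [cγ' h0 h, hD, sub_eq_zero]
  · refine and_congr_right' (and_congr_right' (and_congr_right fun h0 => ?_))
    rw [cβ' h0]
  · rfl
  · refine and_congr_right' (and_congr_right fun h3 => ?_)
    rw [cpow h3]
  · refine and_congr_right' (and_congr_right' (and_congr_right fun h0 => ?_))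
    rw [cβ' h0]
  · refine and_congr_right' (and_congr_right fun h3 => ?_)
    rw [cpow h3]
  · rfl

/-! ### The exponents q + 2 and 2q + 1 -/

theorem mainTheorem8 {F : Type*} [Field F] [Finite F] (q : ℕ) (hq : 7 ≤ q)
    (hF : Nat.card F = q ^ 2) (a b c u v A B : F)
    (hab : a ^ (q + 1) = b ^ (q + 1)) (huv : a * v ≠ b * u)
    (hA : A = b * u - a * v) (hB : B = a * u ^ q - b * v ^ q)
    (m : ℕ) (hm : 1 ≤ m) (hmq : m ≤ q) :
    (∀ α β γ : F,
      α = B + B ^ q →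
      β = (2 * a ^ q * c + b * c ^ q) * B + (a ^ q * c + 2 * b * c ^ q) * B ^ q →
      γ = 2 * α * c ^ (q + 1) + A * c ^ (2 * q) + A ^ q * c ^ 2
            + u ^ (q + 1) - v ^ (q + 1) →
      (PolyIsManyToOne m (fPoly q (q + 2) a b c u v) ↔ SevenCases q m a b c u v α β γ)) ∧
    (∀ α β γ : F,
      α = A + A ^ q →
      β = (2 * a ^ q * c + b * c ^ q) * A + (a ^ q * c + 2 * b * c ^ q) * A ^ q →
      γ = 2 * α * c ^ (q + 1) + B * c ^ (2 * q) + B ^ q * c ^ 2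
            + u ^ (q + 1) - v ^ (q + 1) →
      (PolyIsManyToOne m (fPoly q (2 * q + 1) a b c u v) ↔ SevenCases q m a b c u v α β γ)) := by
  obtain ⟨φ, hφ, hφφ⟩ := exists_ringHom_eq_pow hF
  have hs : ∀ x : F, x ^ (q + 1) = x * φ x := fun x => by rw [pow_succ, hφ, mul_comm]
  have hd : ∀ x : F, x ^ (2 * q) = φ x ^ 2 := fun x => by rw [mul_comm, pow_mul, hφ]
  rw [hs, hs] at hab
  rw [hφ, hφ] at hB
  have hA0 : A ≠ 0 := by
    rw [hA]
    exact sub_ne_zero.2 (Ne.symm huv)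
  have hbA : b * φ A = φ a * B := by
    rw [hA, hB, map_sub, map_mul, map_mul]
    linear_combination -φ u * hab
  have hbB : b * φ B = φ a * A := by
    rw [hA, hB, map_sub, map_mul, map_mul, hφφ, hφφ]
    linear_combination v * hab
  have hB0 : B ≠ 0 := by
    rintro rfl
    have hb : b ≠ 0 := by
      rintro rfl
      have : a = 0 := by simpa using hab
      exact huv (by rw [this]; ring)
    exact mul_ne_zero hb ((map_ne_zero φ).2 hA0) (by rw [hbA, mul_zero])
  constructor
  · intro α β γ hα hβ hγ
    rw [hs, hs, hs, hd, hφ] at hγ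
    rw [hφ] at hα
    rw [hφ, hφ, hφ] at hβ
    -- With L the affine form, `φ` swaps L^(q+2) and L^(2q+1). The form for exponent q + 2 therefore
    -- has (P, Q) = (B, A), and the form for 2q + 1 has (A, B).
    rw [← isManyToOne_iff_sevenCases hq hF hφ hφφ hm hmq hab huv hA hB hbB hbA hB0
      (Y := fun x => (a * φ x + b * x + c) ^ (q + 2)) ?_ ?_ hα hβ hγ]
    · simp [PolyIsManyToOne, fPoly, hφ]
    · intro x
      simp only [pow_add, hφ, map_mul, map_pow, hφφ]
      ring
    · intro x x' h
      simp only [h]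
  · intro α β γ hα hβ hγ
    rw [hs, hs, hs, hd, hφ] at hγ
    rw [hφ] at hα
    rw [hφ, hφ, hφ] at hβ
    rw [← isManyToOne_iff_sevenCases hq hF hφ hφφ hm hmq hab huv hA hB hbA hbB hA0
      (Y := fun x => (a * φ x + b * x + c) ^ (2 * q + 1)) ?_ ?_ hα hβ hγ]
    · simp [PolyIsManyToOne, fPoly, hφ]
    · intro x
      simp only [pow_succ _ (2 * q), hd, map_mul, map_pow, hφφ]
      ring
    · intro x x' h
      simp only [h]
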